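/- Let $\Gamma$ be a discrete subgroup of $\mathrm{SL}(3,\mathbb{R})$ which is Zariski-dense in $\mathrm{SL}(3,\mathbb{R})$. Suppose there exists an element $\gamma_0\in\Gamma$ that has a complex eigenvalue $\lambda e^{2\pi i\theta}$ for some real $\lambda>1$ and some irrational real $\theta$. Then $\Gamma$ acts minimally on the space $\mathrm{Flag}(\mathbb{R}^3)$ of complete flags $\{0\}\subset V_1\subset V_2\subset\mathbb{R}^3$ ($\dim V_i=i$), with its usual topology; that is, for every flag $F\in\mathrm{Flag}(\mathbb{R}^3)$ the orbit $\Gamma\cdot F$ is dense in $\mathrm{Flag}(\mathbb{R}^3)$. -/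

import Mathlib

/-- A complete flag `0 ⊂ V₁ ⊂ V₂ ⊂ ℝ³`: equivalently a point `ℙ(V₁)` on a line `ℙ(V₂)` of the
projective plane. -/
@[ext]
structure FlagR3 where
  /-- the one-dimensional subspace `V₁` -/
  V₁ : Submodule ℝ (Fin 3 → ℝ)
  /-- the two-dimensional subspace `V₂` -/
  V₂ : Submodule ℝ (Fin 3 → ℝ)
  finrank_V₁ : Module.finrank ℝ V₁ = 1
  finrank_V₂ : Module.finrank ℝ V₂ = 2
  V₁_le_V₂ : V₁ ≤ V₂

namespace FlagR3

/-- The flag `span {v₀} ⊂ span {v₀, v₁}` of a linearly independent pair `(v₀, v₁)` in `ℝ³`. -/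
def ofFrame (v : {v : Fin 2 → Fin 3 → ℝ // LinearIndependent ℝ v}) : FlagR3 where
  V₁ := Submodule.span ℝ {v.1 0}
  V₂ := Submodule.span ℝ (Set.range v.1)
  finrank_V₁ := finrank_span_singleton (v.2.ne_zero 0)
  finrank_V₂ := by simpa using finrank_span_eq_card v.2
  V₁_le_V₂ := Submodule.span_mono (Set.singleton_subset_iff.2 (Set.mem_range_self 0))

/-- The usual topology of the flag manifold, as the quotient topology of the space of linearly
independent pairs. -/
instance : TopologicalSpace FlagR3 :=
  TopologicalSpace.coinduced ofFrame inferInstance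

/-- The action of `SL(3, ℝ)` on flags, `g • (V₁ ⊂ V₂) = (g V₁ ⊂ g V₂)`. -/
instance : MulAction (Matrix.SpecialLinearGroup (Fin 3) ℝ) FlagR3 where
  smul g F :=
    { V₁ := F.V₁.map (Matrix.SpecialLinearGroup.toLin' g).toLinearMap
      V₂ := F.V₂.map (Matrix.SpecialLinearGroup.toLin' g).toLinearMap
      finrank_V₁ := (LinearEquiv.finrank_map_eq _ _).trans F.finrank_V₁
      finrank_V₂ := (LinearEquiv.finrank_map_eq _ _).trans F.finrank_V₂
      V₁_le_V₂ := Submodule.map_mono F.V₁_le_V₂ }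
  one_smul F := by
    apply FlagR3.ext
    · change F.V₁.map _ = F.V₁
      rw [map_one]
      exact Submodule.map_id _
    · change F.V₂.map _ = F.V₂
      rw [map_one]
      exact Submodule.map_id _
  mul_smul g h F := by
    apply FlagR3.ext
    · change F.V₁.map _ = (F.V₁.map _).map _
      rw [map_mul, ← Submodule.map_comp]
      rfl
    · change F.V₂.map _ = (F.V₂.map _).map _
      rw [map_mul, ← Submodule.map_comp]
      rfl

end FlagR3

/-- A subset `S` of `SL(n, ℝ)` is Zariski-dense if every real polynomial in the `n²` matrix entries
that vanishes on `S` vanishes on all of `SL(n, ℝ)`. -/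
def IsZariskiDenseInSL {n : ℕ} (S : Set (Matrix.SpecialLinearGroup (Fin n) ℝ)) : Prop :=
  ∀ p : MvPolynomial (Fin n × Fin n) ℝ,
    (∀ g ∈ S, MvPolynomial.eval (fun ij => g.1 ij.1 ij.2) p = 0) →
      ∀ g : Matrix.SpecialLinearGroup (Fin n) ℝ,
        MvPolynomial.eval (fun ij => g.1 ij.1 ij.2) p = 0

open Filter Topology

/-! ### Flags described by frames, and their limits. -/

namespace FlagR3

/-! The element `γ₀` acts on `ℝ³ = P ⊕ ℝe` as an expanding irrational rotation on the plane `P` and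
as a contraction on the line `ℝe`. Let `C` be nonempty, closed and `Γ`-invariant. (1) By Zariski
density some flag of `C` has a plane avoiding `e`. Positive powers of `γ₀` push that plane to `P`,
while the rotation carries the line close to any prescribed line of `P`. So `C` contains every flag
with plane `P` (`mem_of_V₂_eq_complexPlane`). (2) Dually, negative powers show that `C` contains
every flag with line `ℝe` (`mem_of_mem_V₁`). Both facts hold for every such `C`. By (1), `planeCore
C` is again nonempty, closed and invariant; by (2) applied to it, so is `lineCore (planeCore C)`; by
(1) once more, the latter contains every flag with plane `P`. Any flag `(L, Q)` is reached from one
of these: choose a line `M` in `P ∩ Q` and pass from `(M, P)` to `(M, Q)`, then to `(L, Q)`. -/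

theorem smul_V₁ (g : Matrix.SpecialLinearGroup (Fin 3) ℝ) (F : FlagR3) :
    (g • F).V₁ = F.V₁.map (Matrix.SpecialLinearGroup.toLin' g).toLinearMap := rfl

theorem smul_V₂ (g : Matrix.SpecialLinearGroup (Fin 3) ℝ) (F : FlagR3) :
    (g • F).V₂ = F.V₂.map (Matrix.SpecialLinearGroup.toLin' g).toLinearMap := rfl

theorem toLin'_mem_smul_V₁ {g : Matrix.SpecialLinearGroup (Fin 3) ℝ} {F : FlagR3}
    {x : Fin 3 → ℝ} (hx : x ∈ F.V₁) : Matrix.SpecialLinearGroup.toLin' g x ∈ (g • F).V₁ :=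
  Submodule.mem_map_of_mem (f := (Matrix.SpecialLinearGroup.toLin' g).toLinearMap) hx

theorem toLin'_mem_smul_V₂ {g : Matrix.SpecialLinearGroup (Fin 3) ℝ} {F : FlagR3}
    {x : Fin 3 → ℝ} (hx : x ∈ F.V₂) : Matrix.SpecialLinearGroup.toLin' g x ∈ (g • F).V₂ :=
  Submodule.mem_map_of_mem (f := (Matrix.SpecialLinearGroup.toLin' g).toLinearMap) hx

theorem ofFrame_eq {F : FlagR3} (v : {v : Fin 2 → Fin 3 → ℝ // LinearIndependent ℝ v})
    (h₀ : v.1 0 ∈ F.V₁) (h₁ : v.1 1 ∈ F.V₂) : ofFrame v = F := by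
  apply FlagR3.ext
  · apply Submodule.eq_of_le_of_finrank_eq
    · exact (Submodule.span_singleton_le_iff_mem _ _).2 h₀
    · rw [(ofFrame v).finrank_V₁, F.finrank_V₁]
  · apply Submodule.eq_of_le_of_finrank_eq
    · refine Submodule.span_le.2 ?_
      rintro _ ⟨i, rfl⟩
      fin_cases i
      · exact F.V₁_le_V₂ h₀
      · exact h₁
    · rw [(ofFrame v).finrank_V₂, F.finrank_V₂]

theorem exists_frame (F : FlagR3) :
    ∃ v : Fin 2 → Fin 3 → ℝ, LinearIndependent ℝ v ∧ v 0 ∈ F.V₁ ∧ v 1 ∈ F.V₂ := by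
  have h₁ := F.finrank_V₁
  have h₂ := F.finrank_V₂
  obtain ⟨x, hx, hx0⟩ : ∃ x ∈ F.V₁, x ≠ 0 := by
    apply Submodule.exists_mem_ne_zero_of_ne_bot
    intro h
    rw [h, finrank_bot] at h₁
    omega
  obtain ⟨y, hy, hy'⟩ : ∃ y ∈ F.V₂, y ∉ F.V₁ := by
    by_contra! h
    have := Submodule.finrank_mono (show F.V₂ ≤ F.V₁ from h)
    omega
  refine ⟨![x, y], (LinearIndependent.pair_iff' hx0).2 fun a ha => hy' ?_, hx, hy⟩
  rw [← ha]
  exact F.V₁.smul_mem a hx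

theorem frame_mem (v : {v : Fin 2 → Fin 3 → ℝ // LinearIndependent ℝ v}) :
    v.1 0 ∈ (ofFrame v).V₁ ∧ v.1 1 ∈ (ofFrame v).V₂ :=
  ⟨Submodule.mem_span_singleton_self _, Submodule.subset_span (Set.mem_range_self 1)⟩

theorem continuous_frame_apply (i : Fin 2) :
    Continuous fun v : {v : Fin 2 → Fin 3 → ℝ // LinearIndependent ℝ v} => v.1 i :=
  (continuous_apply i).comp continuous_subtype_val

theorem continuous_ofFrame : Continuous ofFrame := continuous_coinduced_rng

/-- Independence is an open condition, so frames mapped outside `C` form an open set of pairs;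
dependent pairs satisfy the condition vacuously. -/
theorem isClosed_setOf_frame {X : Type*} [TopologicalSpace X] {f : X → Fin 2 → Fin 3 → ℝ}
    (hf : Continuous f) {C : Set FlagR3} (hC : IsClosed C) :
    IsClosed {x | ∀ h : LinearIndependent ℝ (f x), ofFrame ⟨f x, h⟩ ∈ C} := by
  have : {x | ∀ h : LinearIndependent ℝ (f x), ofFrame ⟨f x, h⟩ ∈ C}
      = (f ⁻¹' (Subtype.val '' (ofFrame ⁻¹' Cᶜ)))ᶜ := by
    ext x
    simp
  rw [this]
  exact ((isOpen_setOfPred_linearIndependent.isOpenMap_subtype_val _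
    (hC.isOpen_compl.preimage continuous_ofFrame)).preimage hf).isClosed_compl

/-- Limits of flags may be computed on spanning frames. -/
theorem mem_of_tendsto_frame {C : Set FlagR3} (hC : IsClosed C) {F : ℕ → FlagR3} {G : FlagR3}
    (hF : ∀ n, F n ∈ C) {w : ℕ → Fin 2 → Fin 3 → ℝ} {v : Fin 2 → Fin 3 → ℝ}
    (hw₀ : ∀ n, w n 0 ∈ (F n).V₁) (hw₁ : ∀ n, w n 1 ∈ (F n).V₂)
    (hv : LinearIndependent ℝ v) (hv₀ : v 0 ∈ G.V₁) (hv₁ : v 1 ∈ G.V₂)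
    (hlim : Tendsto w atTop (𝓝 v)) : G ∈ C := by
  have hcl : IsClosed {x | ∀ h : LinearIndependent ℝ x, ofFrame ⟨x, h⟩ ∈ C} :=
    isClosed_setOf_frame continuous_id hC
  have hmem (n : ℕ) : w n ∈ {x | ∀ h : LinearIndependent ℝ x, ofFrame ⟨x, h⟩ ∈ C} := fun h =>
    (ofFrame_eq (F := F n) ⟨w n, h⟩ (hw₀ n) (hw₁ n)).symm ▸ hF n
  have hlast : v ∈ {x | ∀ h : LinearIndependent ℝ x, ofFrame ⟨x, h⟩ ∈ C} :=
    hcl.mem_of_tendsto hlim (Eventually.of_forall hmem)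
  exact ofFrame_eq (F := G) ⟨v, hv⟩ hv₀ hv₁ ▸ hlast hv

theorem linearIndependent_toLin' (g : Matrix.SpecialLinearGroup (Fin 3) ℝ)
    {v : Fin 2 → Fin 3 → ℝ} (hv : LinearIndependent ℝ v) :
    LinearIndependent ℝ (fun i => Matrix.SpecialLinearGroup.toLin' g (v i)) :=
  hv.map' (Matrix.SpecialLinearGroup.toLin' g).toLinearMap
    (LinearEquiv.ker (Matrix.SpecialLinearGroup.toLin' g))

theorem smul_ofFrame (g : Matrix.SpecialLinearGroup (Fin 3) ℝ)
    (v : {v : Fin 2 → Fin 3 → ℝ // LinearIndependent ℝ v}) :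
    g • ofFrame v = ofFrame ⟨fun i => Matrix.SpecialLinearGroup.toLin' g (v.1 i),
      linearIndependent_toLin' g v.2⟩ :=
  (ofFrame_eq (F := g • ofFrame v) _ (toLin'_mem_smul_V₁ (frame_mem v).1)
    (toLin'_mem_smul_V₂ (frame_mem v).2)).symm

theorem continuous_smul_left (g : Matrix.SpecialLinearGroup (Fin 3) ℝ) :
    Continuous fun F : FlagR3 => g • F := by
  refine continuous_coinduced_dom.2 ?_
  have hg : Continuous fun x : Fin 3 → ℝ => Matrix.SpecialLinearGroup.toLin' g x :=
    LinearMap.continuous_of_finiteDimensional (Matrix.SpecialLinearGroup.toLin' g).toLinearMap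
  let k : {v : Fin 2 → Fin 3 → ℝ // LinearIndependent ℝ v} →
      {v : Fin 2 → Fin 3 → ℝ // LinearIndependent ℝ v} := fun v =>
    ⟨fun i => Matrix.SpecialLinearGroup.toLin' g (v.1 i), linearIndependent_toLin' g v.2⟩
  have hk : Continuous k :=
    Continuous.subtype_mk (continuous_pi fun i => hg.comp (continuous_frame_apply i)) _
  exact (continuous_ofFrame.comp hk).congr fun v => (smul_ofFrame g v).symm

instance : ContinuousConstSMul (Matrix.SpecialLinearGroup (Fin 3) ℝ) FlagR3 :=
  ⟨continuous_smul_left⟩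

/-! ### Closed invariant sets saturated along planes or lines. -/

/-- The flags all of whose companions with the same plane belong to `C`. -/
def planeCore (C : Set FlagR3) : Set FlagR3 := {F | ∀ F' : FlagR3, F'.V₂ = F.V₂ → F' ∈ C}

/-- The flags all of whose companions with the same line belong to `C`. -/
def lineCore (C : Set FlagR3) : Set FlagR3 := {F | ∀ F' : FlagR3, F'.V₁ = F.V₁ → F' ∈ C}

theorem isClosed_planeCore {C : Set FlagR3} (hC : IsClosed C) : IsClosed (planeCore C) := by
  refine isClosed_coinduced.2 ?_
  -- Every frame of the plane is a pair of combinations of `v`. With the coefficients fixed, the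
  -- pair depends continuously on `v`, so each condition is closed.
  have : ofFrame ⁻¹' planeCore C = ⋂ (a : ℝ) (b : ℝ) (c : ℝ) (d : ℝ),
      {v | ∀ h : LinearIndependent ℝ ![a • v.1 0 + b • v.1 1, c • v.1 0 + d • v.1 1],
        ofFrame ⟨_, h⟩ ∈ C} := by
    ext v
    have hspan : ∀ x, x ∈ (ofFrame v).V₂ ↔ ∃ a b : ℝ, a • v.1 0 + b • v.1 1 = x := by
      intro x
      change x ∈ Submodule.span ℝ (Set.range v.1) ↔ _
      rw [show Set.range v.1 = {v.1 0, v.1 1} by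
        ext; simp [Fin.exists_fin_two, eq_comm]]
      exact Submodule.mem_span_pair
    simp only [Set.mem_preimage, Set.mem_iInter, Set.mem_ofPred_eq]
    constructor
    · intro hv a b c d h
      refine hv _ (Submodule.eq_of_le_of_finrank_eq (Submodule.span_le.2 ?_) ?_)
      · rintro _ ⟨i, rfl⟩
        fin_cases i
        · exact (hspan _).2 ⟨a, b, rfl⟩
        · exact (hspan _).2 ⟨c, d, rfl⟩
      · rw [FlagR3.finrank_V₂, FlagR3.finrank_V₂]
    · intro hv F' hF'
      obtain ⟨w, hw, h₀, h₁⟩ := F'.exists_frame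
      obtain ⟨a, b, hab⟩ := (hspan (w 0)).1 (hF' ▸ F'.V₁_le_V₂ h₀)
      obtain ⟨c, d, hcd⟩ := (hspan (w 1)).1 (hF' ▸ h₁)
      have hwv : ![a • v.1 0 + b • v.1 1, c • v.1 0 + d • v.1 1] = w := by
        rw [hab, hcd]
        ext i
        fin_cases i <;> rfl
      have hli : LinearIndependent ℝ ![a • v.1 0 + b • v.1 1, c • v.1 0 + d • v.1 1] := by
        rwa [hwv]
      have := hv a b c d hli
      rwa [ofFrame_eq (F := F') ⟨_, hli⟩ (by simpa [hab] using h₀) (by simpa [hcd] using h₁)]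
        at this
  rw [this]
  refine isClosed_iInter fun a => isClosed_iInter fun b => isClosed_iInter fun c =>
    isClosed_iInter fun d => isClosed_setOf_frame ?_ hC
  refine continuous_pi fun i => ?_
  have h₀ := continuous_frame_apply 0
  have h₁ := continuous_frame_apply 1
  fin_cases i
  · exact (h₀.const_smul a).add (h₁.const_smul b)
  · exact (h₀.const_smul c).add (h₁.const_smul d)

theorem isClosed_lineCore {C : Set FlagR3} (hC : IsClosed C) : IsClosed (lineCore C) := by
  refine isClosed_coinduced.2 ?_
  -- The second frame vector ranges over all of `ℝ³`, independently of `v`.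
  have : ofFrame ⁻¹' lineCore C = ⋂ w : Fin 3 → ℝ,
      {v | ∀ h : LinearIndependent ℝ ![v.1 0, w], ofFrame ⟨_, h⟩ ∈ C} := by
    ext v
    simp only [Set.mem_preimage, Set.mem_iInter, Set.mem_ofPred_eq]
    constructor
    · intro hv w h
      exact hv _ rfl
    · intro hv F' hF'
      obtain ⟨w, hw, h₀, h₁⟩ := F'.exists_frame
      have hv₀ : v.1 0 ∈ F'.V₁ := hF' ▸ (frame_mem v).1
      have hw₁ : w 1 ∉ F'.V₁ := by
        intro h
        have : F'.V₂ ≤ F'.V₁ := by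
          have := congrArg V₂ (ofFrame_eq ⟨w, hw⟩ h₀ h₁)
          rw [← this]
          refine Submodule.span_le.2 ?_
          rintro _ ⟨i, rfl⟩
          fin_cases i
          · exact h₀
          · exact h
        have := Submodule.finrank_mono this
        rw [F'.finrank_V₁, F'.finrank_V₂] at this
        omega
      have hli : LinearIndependent ℝ ![v.1 0, w 1] :=
        (LinearIndependent.pair_iff' (v.2.ne_zero 0)).2 fun a ha =>
          hw₁ (ha ▸ F'.V₁.smul_mem a hv₀)
      have := hv (w 1) hli
      rwa [ofFrame_eq (F := F') ⟨_, hli⟩ hv₀ h₁] at this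
  rw [this]
  refine isClosed_iInter fun w => isClosed_setOf_frame ?_ hC
  refine continuous_pi fun i => ?_
  fin_cases i
  · exact continuous_frame_apply 0
  · exact continuous_const

theorem smul_mem_planeCore {Γ : Subgroup (Matrix.SpecialLinearGroup (Fin 3) ℝ)} {C : Set FlagR3}
    (hC : ∀ g ∈ Γ, ∀ F ∈ C, g • F ∈ C) : ∀ g ∈ Γ, ∀ F ∈ planeCore C, g • F ∈ planeCore C := by
  intro g hg F hF F' hF'
  have := hC g hg _ (hF (g⁻¹ • F') (by
    rw [smul_V₂, hF', ← smul_V₂, inv_smul_smul]))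
  rwa [smul_inv_smul] at this

theorem smul_mem_lineCore {Γ : Subgroup (Matrix.SpecialLinearGroup (Fin 3) ℝ)} {C : Set FlagR3}
    (hC : ∀ g ∈ Γ, ∀ F ∈ C, g • F ∈ C) : ∀ g ∈ Γ, ∀ F ∈ lineCore C, g • F ∈ lineCore C := by
  intro g hg F hF F' hF'
  have := hC g hg _ (hF (g⁻¹ • F') (by
    rw [smul_V₁, hF', ← smul_V₁, inv_smul_smul]))
  rwa [smul_inv_smul] at this

end FlagR3

/-! ### Zariski density and matrix coefficients. -/

/-- `SL(n, ℝ)` acts irreducibly: no nonzero matrix coefficient vanishes identically. -/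
theorem exists_specialLinear_dotProduct_mulVec_ne_zero {n : ℕ} {a x : Fin n → ℝ} (ha : a ≠ 0)
    (hx : x ≠ 0) : ∃ g : Matrix.SpecialLinearGroup (Fin n) ℝ, a ⬝ᵥ g.1.mulVec x ≠ 0 := by
  by_contra! h
  have h1 : a ⬝ᵥ x = 0 := by simpa using h 1
  -- A transvection changes the coefficient `a ⬝ᵥ x` by exactly `a i * x j`.
  have h2 (i j : Fin n) (hij : i ≠ j) : a i * x j = 0 := by
    have := h ⟨Matrix.transvection i j 1, Matrix.det_transvection_of_ne i j hij 1⟩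
    have hs : (Matrix.single i j (1 : ℝ)).mulVec x = Pi.single i (x j) := by
      simp [Matrix.single_mulVec, Pi.single]
    simpa only [Matrix.transvection, Matrix.add_mulVec, Matrix.one_mulVec, hs, dotProduct_add, h1,
      zero_add, dotProduct_single] using this
  obtain ⟨i, hi⟩ := Function.ne_iff.1 ha
  have hxj (j : Fin n) (hj : j ≠ i) : x j = 0 := by
    simpa [show a i ≠ 0 from hi] using h2 i j hj.symm
  have : a ⬝ᵥ x = a i * x i := by
    rw [dotProduct, Finset.sum_eq_single i (fun j _ hj => by rw [hxj j hj, mul_zero]) (by simp)]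
  replace h1 : x i = 0 := (mul_eq_zero.1 (this ▸ h1)).resolve_left hi
  apply hx
  ext j
  by_cases hj : j = i
  · rw [hj, h1, Pi.zero_apply]
  · exact hxj j hj

/-- A matrix coefficient is a linear polynomial in the entries, so vanishing on `S` would force
vanishing on the whole group. -/
theorem IsZariskiDenseInSL.exists_dotProduct_mulVec_ne_zero {n : ℕ}
    {S : Set (Matrix.SpecialLinearGroup (Fin n) ℝ)} (hS : IsZariskiDenseInSL S)
    {a x : Fin n → ℝ} (ha : a ≠ 0) (hx : x ≠ 0) : ∃ g ∈ S, a ⬝ᵥ g.1.mulVec x ≠ 0 := by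
  by_contra! h
  obtain ⟨g, hg⟩ := exists_specialLinear_dotProduct_mulVec_ne_zero ha hx
  have heval (g : Matrix.SpecialLinearGroup (Fin n) ℝ) :
      MvPolynomial.eval (fun ij => g.1 ij.1 ij.2)
        (∑ i, MvPolynomial.C (a i) * ∑ j, MvPolynomial.X (i, j) * MvPolynomial.C (x j))
      = a ⬝ᵥ g.1.mulVec x := by
    simp [dotProduct, Matrix.mulVec]
  exact hg (by rw [← heval]; exact hS _ (fun g hg => by rw [heval]; exact h g hg) g)

theorem IsZariskiDenseInSL.exists_toLin'_apply_ne_zero {n : ℕ}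
    {S : Set (Matrix.SpecialLinearGroup (Fin n) ℝ)} (hS : IsZariskiDenseInSL S)
    {φ : Module.Dual ℝ (Fin n → ℝ)} {x : Fin n → ℝ} (hφ : φ ≠ 0) (hx : x ≠ 0) :
    ∃ g ∈ S, φ (Matrix.SpecialLinearGroup.toLin' g x) ≠ 0 := by
  have hφ' (y : Fin n → ℝ) : (dotProductEquiv ℝ (Fin n)).symm φ ⬝ᵥ y = φ y := by
    conv_rhs => rw [← (dotProductEquiv ℝ (Fin n)).apply_symm_apply φ]
    rfl
  obtain ⟨g, hg, h⟩ := hS.exists_dotProduct_mulVec_ne_zero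
    (a := (dotProductEquiv ℝ (Fin n)).symm φ) (by simpa using hφ) hx
  exact ⟨g, hg, by rwa [hφ'] at h⟩

/-! ### Irrational rotations and the normal form of the given element. -/

/-- The powers of an irrational rotation accumulate, along arbitrarily large exponents, at every
point of the unit circle. -/
theorem Irrational.exists_tendsto_exp_pow {θ : ℝ} (hθ : Irrational θ) {α : ℂ} (hα : ‖α‖ = 1) :
    ∃ ψ : ℕ → ℕ, StrictMono ψ ∧
      Tendsto (fun n => Complex.exp (2 * (Real.pi : ℂ) * Complex.I * (θ : ℂ)) ^ ψ n)
        atTop (𝓝 α) := by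
  obtain ⟨a, ha⟩ := (AddCircle.homeomorphCircle (one_ne_zero (α := ℝ))).surjective
    ⟨α, by simpa [Submonoid.unitSphere] using hα⟩
  have hd : DenseRange (· • (θ : AddCircle (1 : ℝ)) : ℤ → AddCircle (1 : ℝ)) :=
    AddCircle.denseRange_zsmul_coe_iff.2 (by simpa using hθ)
  -- On the circle, the closure of the integer multiples consists of cluster points of the natural
  -- multiples, so positive exponents suffice.
  have hcl : MapClusterPt a atTop (· • (θ : AddCircle (1 : ℝ)) : ℕ → AddCircle (1 : ℝ)) :=
    ((mapClusterPt_atTop_nsmul_tfae a (θ : AddCircle (1 : ℝ))).out 0 3).2 (hd a)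
  obtain ⟨ψ, hψ, hlim⟩ := hcl.tendsto_subseq
  refine ⟨ψ, hψ, ?_⟩
  have hcont : Continuous fun b =>
      ((AddCircle.homeomorphCircle (one_ne_zero (α := ℝ)) b : Circle) : ℂ) :=
    Continuous.comp (by fun_prop : Continuous fun z : Circle => (z : ℂ)) (Homeomorph.continuous _)
  have h1 := (hcont.tendsto a).comp hlim
  rw [show ((AddCircle.homeomorphCircle (one_ne_zero (α := ℝ)) a : Circle) : ℂ) = α from
    congrArg Subtype.val ha] at h1
  refine h1.congr fun n => ?_
  simp only [Function.comp_apply, AddCircle.homeomorphCircle_apply, AddCircle.toCircle_nsmul,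
    AddCircle.toCircle_apply_mk]
  simp only [Circle.coe_pow, Circle.coe_exp]
  congr 2
  push_cast
  ring

/-- A linear automorphism of `ℝ³` of determinant one with a non-real eigenvalue `μ` is linearly
conjugate to the product of multiplication by `μ` on `ℂ` and a homothety of `ℝ`. -/
theorem exists_complex_prod_real_equiv (A : Matrix.SpecialLinearGroup (Fin 3) ℝ) {μ : ℂ}
    (hμ : μ.im ≠ 0)
    (h : Module.End.HasEigenvalue
      (Matrix.toLin' ((A : Matrix (Fin 3) (Fin 3) ℝ).map (algebraMap ℝ ℂ))) μ) :
    ∃ (Φ : (ℂ × ℝ) ≃ₗ[ℝ] (Fin 3 → ℝ)) (κ : ℝ), κ * Complex.normSq μ = 1 ∧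
      ∀ p, Matrix.SpecialLinearGroup.toLin' A (Φ p) = Φ (μ * p.1, κ * p.2) := by
  set f : (Fin 3 → ℝ) →ₗ[ℝ] Fin 3 → ℝ := (Matrix.SpecialLinearGroup.toLin' A).toLinearMap with hf
  obtain ⟨v, hv⟩ := h.exists_hasEigenvector
  have hv0 := hv.2
  have hAv : ((A : Matrix (Fin 3) (Fin 3) ℝ).map (algebraMap ℝ ℂ)).mulVec v = μ • v :=
    hv.apply_eq_smul
  -- The real parts of complex multiples of `v` form the invariant plane. `J` is injective because
  -- `Re (z v) = Re (μ z v) = 0` also kills `Im (z v)` when `μ` is not real.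
  let J : ℂ →ₗ[ℝ] (Fin 3 → ℝ) :=
    { toFun := fun z i => (z * v i).re
      map_add' := fun z w => by ext i; simp [add_mul]
      map_smul' := fun c z => by ext i; simp [mul_assoc] }
  have hJ (z : ℂ) (i : Fin 3) : J z i = (z * v i).re := rfl
  have hfJ (z : ℂ) : f (J z) = J (μ * z) := by
    ext i
    have h1 : f (J z) i = ∑ j, (A : Matrix (Fin 3) (Fin 3) ℝ) i j * (z * v j).re := rfl
    have h2 : ∑ j, ((A : Matrix (Fin 3) (Fin 3) ℝ) i j : ℂ) * v j = μ * v i := congrFun hAv i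
    rw [h1, hJ, mul_comm μ z, mul_assoc, ← h2, Finset.mul_sum, Complex.re_sum]
    refine Finset.sum_congr rfl fun j _ => ?_
    rw [mul_left_comm, Complex.re_ofReal_mul]
  have hJinj : ∀ z, J z = 0 → z = 0 := by
    intro z hz
    by_contra hz0
    apply hv0
    have hz' : J (μ * z) = 0 := by rw [← hfJ, hz, map_zero]
    ext i
    have h1 : (z * v i).re = 0 := congrFun hz i
    have h2 : (μ * z * v i).re = 0 := congrFun hz' i
    have h3 : (z * v i).im = 0 := by
      rw [mul_assoc, Complex.mul_re, h1, mul_zero, zero_sub, neg_eq_zero, mul_eq_zero] at h2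
      exact h2.resolve_left hμ
    exact (mul_eq_zero.1 (Complex.ext (by simpa using h1) (by simpa using h3))).resolve_left hz0
  have hJi : Function.Injective J := (injective_iff_map_eq_zero J).2 hJinj
  obtain ⟨w, hw⟩ : ∃ w, w ∉ LinearMap.range J := by
    by_contra! hc
    have h1 := LinearMap.finrank_range_le J
    rw [LinearMap.range_eq_top.2 hc, finrank_top, Complex.finrank_real_complex] at h1
    simp at h1
  have key (w : Fin 3 → ℝ) (hw : w ∉ LinearMap.range J) :
      Function.Bijective (J.coprod (LinearMap.toSpanSingleton ℝ _ w)) := by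
    have hi : Function.Injective (J.coprod (LinearMap.toSpanSingleton ℝ _ w)) := by
      refine (injective_iff_map_eq_zero _).2 fun ⟨z, c⟩ hzc => ?_
      replace hzc : J z + c • w = 0 := hzc
      have hc : c = 0 := by
        by_contra hc
        refine hw ⟨-(c⁻¹ • z), ?_⟩
        rw [map_neg, map_smul, eq_neg_of_add_eq_zero_left hzc, smul_neg, neg_neg, smul_smul,
          inv_mul_cancel₀ hc, one_smul]
      rw [hc, zero_smul, add_zero] at hzc
      rw [hJinj z hzc, hc]; rfl
    exact ⟨hi, (LinearMap.injective_iff_surjective_of_finrank_eq_finrank (by simp)).1 hi⟩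
  obtain ⟨⟨m, κ⟩, hm⟩ := (key w hw).2 (f w)
  replace hm : J m + κ • w = f w := hm
  have hμκ : (κ : ℂ) - μ ≠ 0 := fun h0 => hμ (by rw [← sub_eq_zero.1 h0, Complex.ofReal_im])
  -- Solves `μ z₀ + m = κ z₀`, which turns `w` into an eigenvector modulo nothing.
  set z₀ : ℂ := m / (κ - μ) with hz₀
  set e := J z₀ + w with he
  have hfe : f e = κ • e := by
    have h1 : μ * z₀ + m = κ • z₀ := by
      rw [hz₀, Complex.real_smul]; field_simp; ring
    rw [he, map_add, hfJ, ← hm, smul_add, ← map_smul, ← h1, map_add, add_assoc]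
  have heJ : e ∉ LinearMap.range J := fun h0 => hw (by
    simpa [he] using (LinearMap.range J).sub_mem h0 ⟨z₀, rfl⟩)
  let Φ := LinearEquiv.ofBijective _ (key e heJ)
  have hΦ (p : ℂ × ℝ) : Φ p = J p.1 + p.2 • e := rfl
  have hfΦ (p : ℂ × ℝ) : f (Φ p) = Φ (μ * p.1, κ * p.2) := by
    rw [hΦ, hΦ, map_add, map_smul, hfJ, hfe, smul_smul, mul_comm κ]
  refine ⟨Φ, κ, ?_, hfΦ⟩
  have hdet : LinearMap.det f = 1 := by
    rw [hf, Matrix.SpecialLinearGroup.toLin'_to_linearMap, LinearMap.det_toLin', A.2]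
  have hconj : f = Φ.toLinearMap ∘ₗ ((LinearMap.mul ℝ ℂ μ).prodMap (LinearMap.mul ℝ ℝ κ)) ∘ₗ
      Φ.symm.toLinearMap := by
    apply LinearMap.ext
    intro x
    have := hfΦ (Φ.symm x)
    rw [Φ.apply_symm_apply] at this
    rw [this]
    rfl
  rw [hconj, LinearMap.det_conj, LinearMap.det_prodMap] at hdet
  -- The real determinant of multiplication by `μ` is the norm of `μ` from `ℂ` to `ℝ`.
  have h1 : LinearMap.det (LinearMap.mul ℝ ℂ μ) = Complex.normSq μ :=
    Algebra.norm_complex_apply μ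
  have h2 : LinearMap.det (LinearMap.mul ℝ ℝ κ) = κ := by
    simp
  rw [h1, h2] at hdet
  rw [mul_comm, hdet]

namespace FlagR3

theorem exists_mem_V₂_notMem_V₁ (F : FlagR3) : ∃ y ∈ F.V₂, y ∉ F.V₁ := by
  by_contra! h
  have := Submodule.finrank_mono (show F.V₂ ≤ F.V₁ from h)
  rw [F.finrank_V₁, F.finrank_V₂] at this
  omega

/-! ### Limits of flags under positive and negative powers. -/

section Dynamics

variable {A : Matrix.SpecialLinearGroup (Fin 3) ℝ} {Φ : (ℂ × ℝ) ≃ₗ[ℝ] (Fin 3 → ℝ)}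
  {μ : ℂ} {κ r θ : ℝ}

theorem toLin'_pow_apply_of_conj
    (hA : ∀ p, Matrix.SpecialLinearGroup.toLin' A (Φ p) = Φ (μ * p.1, κ * p.2)) (n : ℕ)
    (p : ℂ × ℝ) :
    Matrix.SpecialLinearGroup.toLin' (A ^ n) (Φ p) = Φ (μ ^ n * p.1, κ ^ n * p.2) := by
  induction n with
  | zero => simp
  | succ n ih =>
    rw [pow_succ', map_mul, LinearEquiv.mul_apply, ih, hA, pow_succ', pow_succ', mul_assoc,
      mul_assoc]

theorem toLin'_inv_pow_apply_of_conj (hμ : μ ≠ 0) (hκ : κ ≠ 0)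
    (hA : ∀ p, Matrix.SpecialLinearGroup.toLin' A (Φ p) = Φ (μ * p.1, κ * p.2)) (n : ℕ)
    (p : ℂ × ℝ) :
    Matrix.SpecialLinearGroup.toLin' (A ^ n)⁻¹ (Φ p)
      = Φ ((μ ^ n)⁻¹ * p.1, (κ ^ n)⁻¹ * p.2) := by
  have h := toLin'_pow_apply_of_conj hA n ((μ ^ n)⁻¹ * p.1, (κ ^ n)⁻¹ * p.2)
  simp only [mul_inv_cancel_left₀ (pow_ne_zero n hμ), mul_inv_cancel_left₀ (pow_ne_zero n hκ)] at h
  rw [show Φ p = _ from h.symm, ← LinearEquiv.mul_apply, ← map_mul, inv_mul_cancel, map_one]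
  rfl

theorem norm_exp_two_pi_mul_I (θ : ℝ) :
    ‖Complex.exp (2 * (Real.pi : ℂ) * Complex.I * (θ : ℂ))‖ = 1 := by
  rw [show 2 * (Real.pi : ℂ) * Complex.I * (θ : ℂ) = ((2 * Real.pi * θ : ℝ) : ℂ) * Complex.I by
    push_cast; ring]
  exact Complex.norm_exp_ofReal_mul_I _

/-- The plane corresponding to `ℂ × 0` under `Φ`. -/
noncomputable def complexPlane (Φ : (ℂ × ℝ) ≃ₗ[ℝ] (Fin 3 → ℝ)) : Submodule ℝ (Fin 3 → ℝ) :=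
  LinearMap.ker (LinearMap.snd ℝ ℂ ℝ ∘ₗ Φ.symm.toLinearMap)

theorem mem_complexPlane {x : Fin 3 → ℝ} : x ∈ complexPlane Φ ↔ (Φ.symm x).2 = 0 := Iff.rfl

theorem finrank_complexPlane : Module.finrank ℝ (complexPlane Φ) = 2 := by
  have h := LinearMap.finrank_range_add_finrank_ker (LinearMap.snd ℝ ℂ ℝ ∘ₗ Φ.symm.toLinearMap)
  have hs : LinearMap.range (LinearMap.snd ℝ ℂ ℝ ∘ₗ Φ.symm.toLinearMap) = ⊤ :=
    LinearMap.range_eq_top.2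
      ((LinearMap.snd_surjective (R := ℝ) (M := ℂ) (M₂ := ℝ)).comp Φ.symm.surjective)
  rw [hs, finrank_top] at h
  simp only [Module.finrank_self, Module.finrank_fin_fun] at h
  change 1 + Module.finrank ℝ (complexPlane Φ) = 3 at h
  omega

variable {Γ : Subgroup (Matrix.SpecialLinearGroup (Fin 3) ℝ)} {C : Set FlagR3}

/-- Rotations act transitively on the real lines of `ℂ`; this selects the limiting rotation `α`. -/
theorem exists_unit_mul_eq_smul {z y : ℂ} (hz : z ≠ 0) (hy : y ≠ 0) :
    ∃ α : ℂ, ‖α‖ = 1 ∧ ∃ t : ℝ, α * z = t • y := by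
  have hz' := norm_ne_zero_iff.2 hz
  have hy' := norm_ne_zero_iff.2 hy
  refine ⟨(‖z‖ / ‖y‖ : ℝ) * (y / z), ?_, ‖z‖ / ‖y‖, ?_⟩
  · rw [norm_mul, norm_div, Complex.norm_real, Real.norm_of_nonneg (by positivity)]
    field_simp
  · rw [Complex.real_smul, mul_assoc, div_mul_cancel₀ _ hz]

theorem tendsto_frame_of_conj {z : ℕ → Fin 2 → ℂ} {c : ℕ → Fin 2 → ℝ} {z' : Fin 2 → ℂ}
    {c' : Fin 2 → ℝ} (hz : ∀ i, Tendsto (fun n => z n i) atTop (𝓝 (z' i)))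
    (hc : ∀ i, Tendsto (fun n => c n i) atTop (𝓝 (c' i))) :
    Tendsto (fun n i => Φ (z n i, c n i)) atTop (𝓝 fun i => Φ (z' i, c' i)) := by
  have hΦ : Continuous fun p => Φ p := LinearMap.continuous_of_finiteDimensional Φ.toLinearMap
  exact tendsto_pi_nhds.2 fun i =>
    (hΦ.tendsto (z' i, c' i)).comp ((hz i).prodMk_nhds (hc i))

/-- A nonempty closed invariant set of flags contains all flags whose plane is the plane on which
`A` acts as an expanding irrational rotation. -/
theorem mem_of_V₂_eq_complexPlane
    (hdense : IsZariskiDenseInSL (Γ : Set (Matrix.SpecialLinearGroup (Fin 3) ℝ)))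
    (hAΓ : A ∈ Γ) (hr : 1 < r) (hκ : κ * r ^ 2 = 1) (hθ : Irrational θ)
    (hμ : μ = r * Complex.exp (2 * (Real.pi : ℂ) * Complex.I * (θ : ℂ)))
    (hA : ∀ p, Matrix.SpecialLinearGroup.toLin' A (Φ p) = Φ (μ * p.1, κ * p.2))
    (hC : IsClosed C) (hinv : ∀ g ∈ Γ, ∀ F ∈ C, g • F ∈ C) (hne : C.Nonempty)
    {G : FlagR3} (hG : G.V₂ = complexPlane Φ) : G ∈ C := by
  -- Choose `φ` vanishing on the plane and `g` with `φ (g e) ≠ 0`; then `g⁻¹` moves the plane off `e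
  -- = Φ (0, 1)`.
  obtain ⟨F, hF, he⟩ : ∃ F ∈ C, Φ (0, 1) ∉ F.V₂ := by
    obtain ⟨F, hF⟩ := hne
    obtain ⟨φ, hφ, hφF⟩ := Submodule.exists_le_ker_of_lt_top F.V₂ (lt_top_iff_ne_top.2 fun h => by
      have := F.finrank_V₂
      rw [h, finrank_top, Module.finrank_fin_fun] at this
      omega)
    obtain ⟨g, hg, hgφ⟩ := hdense.exists_toLin'_apply_ne_zero hφ
      (x := Φ (0, 1)) (by simp)
    refine ⟨g⁻¹ • F, hinv _ (Γ.inv_mem hg) _ hF, fun h => hgφ (hφF ?_)⟩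
    have := toLin'_mem_smul_V₂ (g := g) h
    rwa [smul_inv_smul] at this
  obtain ⟨v, hv, h₀, h₁⟩ := F.exists_frame
  have hvF (i : Fin 2) : v i ∈ F.V₂ := by
    fin_cases i
    exacts [F.V₁_le_V₂ h₀, h₁]
  set z : Fin 2 → ℂ := fun i => (Φ.symm (v i)).1 with hz
  set c : Fin 2 → ℝ := fun i => (Φ.symm (v i)).2 with hc
  have hvz (i : Fin 2) : v i = Φ (z i, c i) := (Φ.apply_symm_apply _).symm
  -- Projection to `ℂ` along `e` is injective on a plane that avoids `e`.
  have hzli : LinearIndependent ℝ z := by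
    rw [Fintype.linearIndependent_iff] at hv ⊢
    intro t ht
    have hsum : ∑ i, t i • v i = (∑ i, t i * c i) • Φ (0, 1) := by
      simp only [hvz, ← map_smul, ← map_sum]
      congr 1
      ext1
      · simpa [Prod.fst_sum] using ht
      · simp
    refine hv t ?_
    have hmem : ∑ i, t i • v i ∈ F.V₂ := F.V₂.sum_mem fun i _ => F.V₂.smul_mem _ (hvF i)
    rw [hsum] at hmem ⊢
    by_cases h0 : ∑ i, t i * c i = 0
    · rw [h0, zero_smul]
    · exact absurd ((F.V₂.smul_mem_iff h0).1 hmem) he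
  obtain ⟨x, hx, hx0⟩ : ∃ x ∈ G.V₁, x ≠ 0 := by
    obtain ⟨w, hw, hw₀, -⟩ := G.exists_frame
    exact ⟨w 0, hw₀, hw.ne_zero 0⟩
  have hxP : (Φ.symm x).2 = 0 := mem_complexPlane.1 (hG ▸ G.V₁_le_V₂ hx)
  set y := (Φ.symm x).1 with hy
  have hxy : x = Φ (y, 0) := by rw [← hxP, hy, Prod.mk.eta, Φ.apply_symm_apply]
  have hy0 : y ≠ 0 := fun h => hx0 (by rw [hxy, h]; exact map_zero Φ)
  obtain ⟨α, hα, t, hαt⟩ := exists_unit_mul_eq_smul (hzli.ne_zero 0) hy0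
  have hα0 : α ≠ 0 := norm_ne_zero_iff.1 (by rw [hα]; exact one_ne_zero)
  obtain ⟨ψ, hψ, hlim⟩ := hθ.exists_tendsto_exp_pow hα
  have hr0 : (r : ℂ) ≠ 0 := Complex.ofReal_ne_zero.2 (by positivity)
  have hκ0 : 0 < κ := by
    by_contra! h
    nlinarith [sq_nonneg r]
  have hκ1 : κ < 1 := by nlinarith
  have hq : Tendsto (fun n => (κ / r) ^ ψ n) atTop (𝓝 0) :=
    (tendsto_pow_atTop_nhds_zero_of_lt_one (by positivity)
      ((div_lt_one (by positivity)).2 (by linarith))).comp hψ.tendsto_atTop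
  -- Rescaling by `r⁻ⁿ` leaves a pure rotation on `ℂ` and the factor `(κ / r)ⁿ`, which tends to `0`,
  -- on `ℝ`.
  have hframe (n : ℕ) (i : Fin 2) :
      Φ (Complex.exp (2 * (Real.pi : ℂ) * Complex.I * (θ : ℂ)) ^ ψ n * z i, (κ / r) ^ ψ n * c i)
        = (r ^ ψ n)⁻¹ • Matrix.SpecialLinearGroup.toLin' (A ^ ψ n) (v i) := by
    rw [hvz, toLin'_pow_apply_of_conj hA, ← map_smul]
    congr 1
    ext1
    · simp only [Prod.smul_fst, Complex.real_smul, hμ, mul_pow]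
      push_cast
      field_simp
    · simp only [Prod.smul_snd, smul_eq_mul, div_pow]
      field_simp
  refine mem_of_tendsto_frame hC (F := fun n => A ^ ψ n • F)
    (v := fun i => Φ (α * z i, 0))
    (fun n => hinv _ (Γ.pow_mem hAΓ _) _ hF) (fun n => ?_) (fun n => ?_) ?_ ?_ ?_
    (tendsto_frame_of_conj (fun i => hlim.mul_const (z i))
      fun i => by simpa using hq.mul_const (c i))
  · rw [hframe]
    exact Submodule.smul_mem _ _ (toLin'_mem_smul_V₁ h₀)
  · rw [hframe]
    exact Submodule.smul_mem _ _ (toLin'_mem_smul_V₂ h₁)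
  · refine hzli.map' (Φ.toLinearMap ∘ₗ LinearMap.inl ℝ ℂ ℝ ∘ₗ LinearMap.mul ℝ ℂ α)
      (LinearMap.ker_eq_bot.2 ?_)
    exact Φ.injective.comp (LinearMap.inl_injective.comp (mul_right_injective₀ hα0))
  · have : Φ (α * z 0, 0) = t • x := by
      rw [hαt, hxy, ← map_smul, Prod.smul_mk, smul_zero]
    rw [this]
    exact Submodule.smul_mem _ _ hx
  · rw [hG, mem_complexPlane, Φ.symm_apply_apply]

/-- A nonempty closed invariant set of flags contains all flags through the contracted eigenline
of `A`. -/
theorem mem_of_mem_V₁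
    (hdense : IsZariskiDenseInSL (Γ : Set (Matrix.SpecialLinearGroup (Fin 3) ℝ)))
    (hAΓ : A ∈ Γ) (hr : 1 < r) (hκ : κ * r ^ 2 = 1) (hθ : Irrational θ)
    (hμ : μ = r * Complex.exp (2 * (Real.pi : ℂ) * Complex.I * (θ : ℂ)))
    (hA : ∀ p, Matrix.SpecialLinearGroup.toLin' A (Φ p) = Φ (μ * p.1, κ * p.2))
    (hC : IsClosed C) (hinv : ∀ g ∈ Γ, ∀ F ∈ C, g • F ∈ C) (hne : C.Nonempty)
    {G : FlagR3} (hG : Φ (0, 1) ∈ G.V₁) : G ∈ C := by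
  obtain ⟨F, hF, x, hx, hxF⟩ : ∃ F ∈ C, ∃ x ∈ F.V₁, (Φ.symm x).2 ≠ 0 := by
    obtain ⟨F, hF⟩ := hne
    obtain ⟨v, hv, h₀, -⟩ := F.exists_frame
    obtain ⟨g, hg, hgφ⟩ := hdense.exists_toLin'_apply_ne_zero
      (φ := LinearMap.snd ℝ ℂ ℝ ∘ₗ Φ.symm.toLinearMap) (fun h => by
        have := LinearMap.congr_fun h (Φ (0, 1))
        simp at this) (hv.ne_zero 0)
    exact ⟨g • F, hinv _ hg _ hF, _, toLin'_mem_smul_V₁ h₀, hgφ⟩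
  obtain ⟨z₀, c₀, rfl⟩ : ∃ z c, x = Φ (z, c) := ⟨_, _, (Φ.apply_symm_apply x).symm⟩
  replace hxF : c₀ ≠ 0 := by simpa using hxF
  -- As the line of `F` is not in the complex plane, subtracting a multiple of `x` gives a vector of
  -- `F.V₂` lying in that plane.
  obtain ⟨z₁, hz₁, hz₁0⟩ : ∃ z, Φ (z, 0) ∈ F.V₂ ∧ z ≠ 0 := by
    obtain ⟨w, hw, hwF⟩ := F.exists_mem_V₂_notMem_V₁
    obtain ⟨z, c, rfl⟩ : ∃ z c, w = Φ (z, c) := ⟨_, _, (Φ.apply_symm_apply w).symm⟩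
    have heq : Φ (z, c) - (c / c₀) • Φ (z₀, c₀) = Φ (z - (c / c₀) • z₀, 0) := by
      rw [← map_smul, ← map_sub, Prod.smul_mk, Prod.mk_sub_mk, smul_eq_mul,
        div_mul_cancel₀ _ hxF, sub_self]
    refine ⟨z - (c / c₀) • z₀, heq ▸ F.V₂.sub_mem hw (F.V₂.smul_mem _ (F.V₁_le_V₂ hx)),
      fun h => hwF ?_⟩
    rw [h, show Φ (0, 0) = 0 from map_zero Φ, sub_eq_zero] at heq
    rw [heq]
    exact F.V₁.smul_mem _ hx
  obtain ⟨y, hy, hy0⟩ : ∃ y, Φ (y, 0) ∈ G.V₂ ∧ y ≠ 0 := by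
    obtain ⟨w, hw, hwG⟩ := G.exists_mem_V₂_notMem_V₁
    obtain ⟨y, c, rfl⟩ : ∃ z c, w = Φ (z, c) := ⟨_, _, (Φ.apply_symm_apply w).symm⟩
    have heq : Φ (y, c) - c • Φ (0, 1) = Φ (y, 0) := by
      rw [← map_smul, ← map_sub]
      simp
    refine ⟨y, heq ▸ G.V₂.sub_mem hw (G.V₂.smul_mem _ (G.V₁_le_V₂ hG)), fun h => hwG ?_⟩
    rw [h, show Φ (0, 0) = 0 from map_zero Φ, sub_eq_zero] at heq
    rw [h, heq]
    exact G.V₁.smul_mem _ hG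
  obtain ⟨α, hα, t, hαt⟩ := exists_unit_mul_eq_smul hz₁0 hy0
  have hα0 : α ≠ 0 := norm_ne_zero_iff.1 (by rw [hα]; exact one_ne_zero)
  -- Negative powers rotate backwards, so positive powers are sent to `α⁻¹`.
  obtain ⟨ψ, hψ, hlim⟩ := hθ.exists_tendsto_exp_pow (α := α⁻¹) (by rw [norm_inv, hα, inv_one])
  replace hlim := hlim.inv₀ (inv_ne_zero hα0)
  rw [inv_inv] at hlim
  have hr0 : (r : ℂ) ≠ 0 := Complex.ofReal_ne_zero.2 (by positivity)
  have hκ0 : 0 < κ := by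
    by_contra! h
    nlinarith [sq_nonneg r]
  have hκ1 : κ < 1 := by nlinarith
  have hμr : ‖μ‖ = r := by
    rw [hμ, norm_mul, norm_exp_two_pi_mul_I, mul_one, Complex.norm_real,
      Real.norm_of_nonneg (by positivity)]
  have hμ0 : μ ≠ 0 := norm_ne_zero_iff.1 (by rw [hμr]; positivity)
  have hq : Tendsto (fun n => ((κ : ℂ) / μ) ^ ψ n) atTop (𝓝 0) := by
    refine (tendsto_pow_atTop_nhds_zero_of_norm_lt_one ?_).comp hψ.tendsto_atTop
    rw [norm_div, hμr, Complex.norm_real, Real.norm_of_nonneg hκ0.le,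
      div_lt_one (by positivity)]
    linarith
  set u := Complex.exp (2 * (Real.pi : ℂ) * Complex.I * (θ : ℂ)) with hu
  -- The two frame vectors need different scalings: `κⁿ` fixes the component along `e`, while `rⁿ`
  -- leaves only the rotation in the complex plane.
  have hframe₀ (n : ℕ) : Φ (((κ : ℂ) / μ) ^ ψ n * z₀, c₀)
      = κ ^ ψ n • Matrix.SpecialLinearGroup.toLin' (A ^ ψ n)⁻¹ (Φ (z₀, c₀)) := by
    rw [toLin'_inv_pow_apply_of_conj hμ0 hκ0.ne' hA, ← map_smul]
    congr 1
    ext1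
    · simp only [Prod.smul_fst, Complex.real_smul, div_pow]
      push_cast
      ring
    · simp only [Prod.smul_snd, smul_eq_mul]
      field_simp
  have hframe₁ (n : ℕ) : Φ ((u ^ ψ n)⁻¹ * z₁, 0)
      = r ^ ψ n • Matrix.SpecialLinearGroup.toLin' (A ^ ψ n)⁻¹ (Φ (z₁, 0)) := by
    rw [toLin'_inv_pow_apply_of_conj hμ0 hκ0.ne' hA, ← map_smul]
    congr 1
    ext1
    · simp only [Prod.smul_fst, Complex.real_smul, hμ, mul_pow, mul_inv]
      push_cast
      field_simp
    · simp
  have hαz : Φ (α * z₁, 0) = t • Φ (y, 0) := by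
    rw [hαt, ← map_smul, Prod.smul_mk, smul_zero]
  have hcz : Φ (0, c₀) = c₀ • Φ (0, 1) := by
    rw [← map_smul]
    simp
  refine mem_of_tendsto_frame hC (F := fun n => (A ^ ψ n)⁻¹ • F)
    (v := fun i => Φ ((![0, α * z₁] : Fin 2 → ℂ) i, (![c₀, 0] : Fin 2 → ℝ) i))
    (fun n => hinv _ (Γ.inv_mem (Γ.pow_mem hAΓ _)) _ hF) (fun n => ?_) (fun n => ?_) ?_ ?_ ?_
    (tendsto_frame_of_conj
      (z := fun n => ![((κ : ℂ) / μ) ^ ψ n * z₀, (u ^ ψ n)⁻¹ * z₁]) (c := fun _ => ![c₀, 0])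
      (fun i => ?_) fun i => tendsto_const_nhds)
  · change Φ (((κ : ℂ) / μ) ^ ψ n * z₀, c₀) ∈ _
    rw [hframe₀]
    exact Submodule.smul_mem _ _ (toLin'_mem_smul_V₁ hx)
  · change Φ ((u ^ ψ n)⁻¹ * z₁, 0) ∈ _
    rw [hframe₁]
    exact Submodule.smul_mem _ _ (toLin'_mem_smul_V₂ hz₁)
  · have h : LinearIndependent ℝ
        ![((0, c₀) : ℂ × ℝ), ((α * z₁, 0) : ℂ × ℝ)] := by
      refine (LinearIndependent.pair_iff' (by simp [hxF])).2 fun a ha => ?_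
      exact mul_ne_zero hα0 hz₁0 (by simpa using (congrArg Prod.fst ha).symm)
    have heq : (fun i => Φ ((![0, α * z₁] : Fin 2 → ℂ) i, (![c₀, 0] : Fin 2 → ℝ) i))
        = Φ.toLinearMap ∘ ![((0, c₀) : ℂ × ℝ), ((α * z₁, 0) : ℂ × ℝ)] := by
      funext i
      fin_cases i <;> rfl
    rw [heq]
    exact h.map' Φ.toLinearMap Φ.ker
  · change Φ (0, c₀) ∈ _
    rw [hcz]
    exact G.V₁.smul_mem _ hG
  · change Φ (α * z₁, 0) ∈ _
    rw [hαz]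
    exact G.V₂.smul_mem _ hy
  · fin_cases i
    · simpa using hq.mul_const z₀
    · exact hlim.mul_const z₁

/-! ### Conclusion by alternating between planes and lines. -/

/-- The flag with line spanned by `Φ (z, 0)` and plane `Φ (ℂ × 0)`. -/
noncomputable def complexPlaneFlag (Φ : (ℂ × ℝ) ≃ₗ[ℝ] (Fin 3 → ℝ)) {z : ℂ} (hz : z ≠ 0) :
    FlagR3 where
  V₁ := Submodule.span ℝ {Φ (z, 0)}
  V₂ := complexPlane Φ
  finrank_V₁ := finrank_span_singleton (by simpa using hz)
  finrank_V₂ := finrank_complexPlane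
  V₁_le_V₂ := by
    rw [Submodule.span_singleton_le_iff_mem, mem_complexPlane, Φ.symm_apply_apply]

theorem eq_univ_of_isClosed_of_invariant
    (hdense : IsZariskiDenseInSL (Γ : Set (Matrix.SpecialLinearGroup (Fin 3) ℝ)))
    (hAΓ : A ∈ Γ) (hr : 1 < r) (hκ : κ * r ^ 2 = 1) (hθ : Irrational θ)
    (hμ : μ = r * Complex.exp (2 * (Real.pi : ℂ) * Complex.I * (θ : ℂ)))
    (hA : ∀ p, Matrix.SpecialLinearGroup.toLin' A (Φ p) = Φ (μ * p.1, κ * p.2))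
    (hC : IsClosed C) (hinv : ∀ g ∈ Γ, ∀ F ∈ C, g • F ∈ C) (hne : C.Nonempty) :
    C = Set.univ := by
  have hT := isClosed_planeCore hC
  have hTinv := smul_mem_planeCore hinv
  have hTne : (planeCore C).Nonempty := ⟨complexPlaneFlag Φ one_ne_zero, fun F hF =>
    mem_of_V₂_eq_complexPlane hdense hAΓ hr hκ hθ hμ hA hC hinv hne hF⟩
  have hS := isClosed_lineCore hT
  have hSinv := smul_mem_lineCore hTinv
  have hli : LinearIndependent ℝ ![Φ (0, 1), Φ (1, 0)] := by
    refine (LinearIndependent.pair_iff' (by simp)).2 fun a ha => ?_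
    rw [← map_smul] at ha
    simpa using congrArg Prod.fst (Φ.injective ha)
  have hSne : (lineCore (planeCore C)).Nonempty := ⟨ofFrame ⟨_, hli⟩, fun F hF =>
    mem_of_mem_V₁ hdense hAΓ hr hκ hθ hμ hA hT hTinv hTne (hF ▸ (frame_mem ⟨_, hli⟩).1)⟩
  refine Set.eq_univ_of_forall fun F => ?_
  -- Two planes in `ℝ³` share a nonzero vector.
  obtain ⟨z, hzF, hz⟩ : ∃ z, Φ (z, 0) ∈ F.V₂ ∧ z ≠ 0 := by
    have hlt : 0 < Module.finrank ℝ (F.V₂ ⊓ complexPlane Φ : Submodule ℝ (Fin 3 → ℝ)) := by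
      have h := Submodule.finrank_sup_add_finrank_inf_eq F.V₂ (complexPlane Φ)
      have h' := Submodule.finrank_le (F.V₂ ⊔ complexPlane Φ)
      rw [F.finrank_V₂, finrank_complexPlane] at h
      rw [Module.finrank_fin_fun] at h'
      omega
    obtain ⟨x, hx, hx0⟩ := Submodule.exists_mem_ne_zero_of_ne_bot
      (Submodule.one_le_finrank_iff.1 hlt)
    have hx' : x = Φ ((Φ.symm x).1, 0) := by
      rw [← mem_complexPlane.1 hx.2, Prod.mk.eta, Φ.apply_symm_apply]
    refine ⟨(Φ.symm x).1, hx' ▸ hx.1, fun h => hx0 ?_⟩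
    rw [hx', h]
    exact map_zero Φ
  have hG := mem_of_V₂_eq_complexPlane hdense hAΓ hr hκ hθ hμ hA hS hSinv hSne
    (G := complexPlaneFlag Φ hz) rfl
  let H : FlagR3 :=
    { V₁ := Submodule.span ℝ {Φ (z, 0)}
      -- This intermediate flag shares its line with a flag of plane `Φ (ℂ × 0)` and its plane with
      -- `F`.
      V₂ := F.V₂
      finrank_V₁ := (complexPlaneFlag Φ hz).finrank_V₁
      finrank_V₂ := F.finrank_V₂
      V₁_le_V₂ := (Submodule.span_singleton_le_iff_mem _ _).2 hzF }
  exact hG H rfl F rfl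

end Dynamics

end FlagR3

theorem proposition5p5
    (Γ : Subgroup (Matrix.SpecialLinearGroup (Fin 3) ℝ))
    (hdiscrete : DiscreteTopology Γ)
    (hdense : IsZariskiDenseInSL (Γ : Set (Matrix.SpecialLinearGroup (Fin 3) ℝ)))
    (γ₀ : Matrix.SpecialLinearGroup (Fin 3) ℝ) (hγ₀ : γ₀ ∈ Γ)
    (r θ : ℝ) (hr : 1 < r) (hθ : Irrational θ)
    (heig : Module.End.HasEigenvalue
      (Matrix.toLin' ((γ₀ : Matrix (Fin 3) (Fin 3) ℝ).map (algebraMap ℝ ℂ)))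
      ((r : ℂ) * Complex.exp (2 * (Real.pi : ℂ) * Complex.I * (θ : ℂ)))) :
    MulAction.IsMinimal Γ FlagR3 := by
  -- A real eigenvalue would give `sin (2πθ) = 0`, making `2θ` an integer.
  have him : ((r : ℂ) * Complex.exp (2 * (Real.pi : ℂ) * Complex.I * (θ : ℂ))).im ≠ 0 := by
    rw [Complex.im_ofReal_mul, show 2 * (Real.pi : ℂ) * Complex.I * (θ : ℂ)
      = ((2 * Real.pi * θ : ℝ) : ℂ) * Complex.I by push_cast; ring, Complex.exp_ofReal_mul_I_im]
    refine mul_ne_zero (by positivity) fun h => ?_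
    obtain ⟨n, hn⟩ := Real.sin_eq_zero_iff.1 h
    refine hθ ⟨n / 2, ?_⟩
    have hπ := Real.pi_ne_zero
    push_cast
    field_simp
    apply mul_left_cancel₀ hπ
    linarith
  obtain ⟨Φ, κ, hκ, hA⟩ := exists_complex_prod_real_equiv γ₀ him heig
  rw [Complex.normSq_eq_norm_sq, norm_mul, FlagR3.norm_exp_two_pi_mul_I, mul_one,
    Complex.norm_real, Real.norm_eq_abs, sq_abs] at hκ
  have : ContinuousConstSMul Γ FlagR3 := ⟨fun g => FlagR3.continuous_smul_left g.1⟩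
  rw [isMinimal_iff_isClosed_smul_invariant]
  intro C hC hinv
  refine C.eq_empty_or_nonempty.imp_right fun hne => ?_
  exact FlagR3.eq_univ_of_isClosed_of_invariant hdense hγ₀ hr hκ hθ rfl hA hC
    (fun g hg F hF => hinv ⟨g, hg⟩ (Set.smul_mem_smul_set hF)) hne
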